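/- For a vector $v\in\mathbb R^n$ let $\mathrm D(v)\in\mathbb R^{\binom n2}$ be the vector whose $(i,j)$-coordinate is $v_i-v_j$ for $1\le i<j\le n$, and for $\alpha,\gamma>0$ let $$\operatorname{CLCD}_{\alpha,\gamma}(v):=\inf\Big\{\theta>0:\ \operatorname{dist}\big(\theta\,\mathrm D(v),\mathbb Z^{\binom n2}\big)<\min\big(\gamma\|\theta\,\mathrm D(v)\|_2,\ \alpha\big)\Big\},$$ where $\operatorname{dist}$ is the Euclidean distance (with $\inf\emptyset=\infty$ and $1/\infty=0$). For a real-valued random variable $X$ and $\varepsilon\ge 0$ let $\mathcal L(X,\varepsilon):=\sup_{\lambda\in\mathbb R}\mathbf P(|X-\lambda|\le\varepsilon)$. **Theorem.** For any $b>0$ and $\gamma\in(0,1)$ there exists $C>0$, depending only on $b$ and $\gamma$, for which the following holds. Let $n\ge 2$ be an even integer, let $(\xi_1,\dots,\xi_n)$ be uniformly distributed over the vectors in $\{-1,0,1\}^n$ with exactly $n/2$ nonzero entries, and for $v\in\mathbb R^n$ put $W_v:=\xi_1v_1+\dots+\xi_nv_n$. If $v\in\mathbb R^n$ satisfies $\|\mathrm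 D(v)\|_2\ge b\sqrt n$, then for every $\alpha>0$ and every $\varepsilon\ge 0$, $$\mathcal L(W_v,\varepsilon)\le C\varepsilon+\frac{C}{\operatorname{CLCD}_{\alpha,\gamma}(v)}+C e^{-2\alpha^2/n}.$$ -/

import Mathlib

open MeasureTheory ProbabilityTheory
open scoped ENNReal

noncomputable section

/-- The index set of pairs `(i, j)` with `i < j` in `{1, …, n}`; it has `n.choose 2` elements. -/
abbrev PairIdx (n : ℕ) : Type := {p : Fin n × Fin n // p.1 < p.2}

/-- The vector `D(v)` of Euclidean space indexed by the pairs `i < j`,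
whose `(i, j)`-coordinate is `v i - v j`. -/
def diffVec {n : ℕ} (v : EuclideanSpace ℝ (Fin n)) : EuclideanSpace ℝ (PairIdx n) :=
  WithLp.toLp 2 fun p => v p.1.1 - v p.1.2

/-- The integer lattice in the Euclidean space with coordinates indexed by `ι`. -/
def intLattice (ι : Type*) : Set (EuclideanSpace ℝ ι) :=
  {z | ∀ i, ∃ k : ℤ, z i = (k : ℝ)}

/-- The set of `θ > 0` with `dist(θ D(v), ℤ^(n choose 2)) < min(γ ‖θ D(v)‖₂, α)`. -/
def clcdSet {n : ℕ} (α γ : ℝ) (v : EuclideanSpace ℝ (Fin n)) : Set ℝ :=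
  {θ | 0 < θ ∧
    Metric.infDist (θ • diffVec v) (intLattice (PairIdx n)) < min (γ * ‖θ • diffVec v‖) α}

/-- The combinatorial least common denominator `CLCD_{α,γ}(v)`, the infimum of `clcdSet α γ v`
taken in `[0, ∞]`, so that the infimum of the empty set is `∞`. -/
def clcd {n : ℕ} (α γ : ℝ) (v : EuclideanSpace ℝ (Fin n)) : ℝ≥0∞ :=
  ⨅ θ ∈ clcdSet α γ v, ENNReal.ofReal θ

/-- The Lévy concentration function `sup_{x ∈ ℝ} P(|X - x| ≤ ε)`, with values in `[0, ∞]`. -/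
def levyConcentration {Ω : Type*} [MeasurableSpace Ω] (P : Measure Ω) (X : Ω → ℝ) (ε : ℝ) :
    ℝ≥0∞ :=
  ⨆ x : ℝ, P {ω | |X ω - x| ≤ ε}

/-- The vectors in `{-1, 0, 1}ⁿ` with `∑ |ξ i| = n / 2`, that is, with exactly `n / 2`
nonzero entries (written without division). -/
def signedHalfVectors (n : ℕ) : Set (Fin n → ℤ) :=
  {x | (∀ i, x i = -1 ∨ x i = 0 ∨ x i = 1) ∧ 2 * ∑ i, |x i| = (n : ℤ)}

/-- The random sum `W_v = ∑ ξ i * v i`. -/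
def signedSum {n : ℕ} {Ω : Type*} (ξ : Ω → Fin n → ℤ) (v : EuclideanSpace ℝ (Fin n)) :
    Ω → ℝ :=
  fun ω => ∑ i, (ξ ω i : ℝ) * v i

end

/-! The proof is Fourier-analytic. Averaging over signs and supports, the characteristic function of
`W_v` at `θ` is `e_k(cos θv₁, …, cos θvₙ) / (n choose k)` with `n = 2k` and `e_k` the elementary
symmetric polynomial. As a Fourier coefficient of `∏ (1 + e^{it} cᵢ)`, `e_k` is at most `2^n
exp(-n(1 - r²)/8)` times the mean of `exp(-(n/8) sin² t)`, where `r` is the mean of the `cᵢ`. That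
mean is of order `1/√n`, which offsets `2^n / (n choose k)` of order `√n`, so no power of `n` is
lost (`abs_sum_prod_powersetCard_half_le`).

The same quantity controls the lattice: rounding each pair difference gives `dist(τ D(v), ℤ)² ≤ n²(1
- r²)/16` with `τ = |θ|/2π` (`infDist_sq_smul_diffVec_le`). Hence the characteristic function is at
most `4 exp(-2 dist²/n)`. Below the CLCD, `dist` is at least `α` or at least `γ τ b √n`, giving the
constant `exp(-2α²/n)` or a Gaussian in `θ`. An Esseen inequality at scale `δ ≈ ε + 1/CLCD`
finishes. -/

/-! ### Elementary symmetric polynomials of numbers in `[-1, 1]`. -/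

/-- Orthogonality of the characters `t ↦ exp (i k t)` over a period. -/
theorem integral_exp_int_mul_I (a : ℝ) (k : ℤ) :
    ∫ t in a..a + 2 * Real.pi, Complex.exp ((k * Complex.I) * t)
      = if k = 0 then (2 * Real.pi : ℂ) else 0 := by
  split_ifs with h
  · subst h
    simp
  · have hc : (k * Complex.I : ℂ) ≠ 0 := by simp [h]
    rw [integral_exp_mul_complex hc]
    have h1 : Complex.exp (k * Complex.I * ((a + 2 * Real.pi : ℝ) : ℂ))
        = Complex.exp (k * Complex.I * a) := by
      rw [Complex.exp_eq_exp_iff_exists_int]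
      exact ⟨k, by push_cast; ring⟩
    rw [h1, sub_self, zero_div]

/-- The elementary symmetric polynomial as a Fourier coefficient of `∏ (1 + exp (i t) c i)`. -/
theorem two_pi_mul_abs_sum_prod_le {ι : Type*} [Fintype ι] (c : ι → ℝ) (m : ℕ) (a : ℝ) :
    2 * Real.pi * |∑ T ∈ Finset.powersetCard m Finset.univ, ∏ i ∈ T, c i|
      ≤ ∫ t in a..a + 2 * Real.pi, ∏ i, ‖1 + Complex.exp (t * Complex.I) * c i‖ := by
  have key : ∫ t in a..a + 2 * Real.pi,
      Complex.exp ((-m : ℤ) * Complex.I * t) * ∏ i, (1 + Complex.exp (t * Complex.I) * c i)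
      = 2 * Real.pi * ((∑ T ∈ Finset.powersetCard m Finset.univ, ∏ i ∈ T, c i : ℝ) : ℂ) := by
    have expand : ∀ t : ℝ, Complex.exp ((-m : ℤ) * Complex.I * t) *
        ∏ i, (1 + Complex.exp (t * Complex.I) * c i)
        = ∑ T ∈ (Finset.univ : Finset ι).powerset,
          (∏ i ∈ T, (c i : ℂ)) * Complex.exp (((T.card : ℤ) - m : ℤ) * Complex.I * t) := by
      intro t
      rw [Finset.prod_one_add, Finset.mul_sum]
      refine Finset.sum_congr rfl fun T _ => ?_
      rw [Finset.prod_mul_distrib, Finset.prod_const, ← Complex.exp_nat_mul, ← mul_assoc,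
        ← Complex.exp_add, mul_comm]
      congr 2
      push_cast
      ring
    simp_rw [expand]
    rw [intervalIntegral.integral_finsetSum]
    · simp_rw [intervalIntegral.integral_const_mul, integral_exp_int_mul_I]
      rw [Finset.powersetCard_eq_filter, Finset.sum_filter]
      push_cast
      rw [Finset.mul_sum]
      refine Finset.sum_congr rfl fun T _ => ?_
      by_cases h : T.card = m
      · simp [h, mul_comm]
      · have : ((T.card : ℤ) - m) ≠ 0 := by omega
        simp [h, this]
    · intro T _
      apply Continuous.intervalIntegrable
      fun_prop
  have hn := intervalIntegral.norm_integral_le_integral_norm (μ := volume) (a := a)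
    (b := a + 2 * Real.pi) (f := fun t : ℝ => Complex.exp ((-m : ℤ) * Complex.I * t) *
      ∏ i, (1 + Complex.exp (t * Complex.I) * c i)) (by linarith [Real.pi_pos])
  rw [key] at hn
  have e1 : ‖(2 * Real.pi * ((∑ T ∈ Finset.powersetCard m Finset.univ, ∏ i ∈ T, c i : ℝ) : ℂ))‖
      = 2 * Real.pi * |∑ T ∈ Finset.powersetCard m Finset.univ, ∏ i ∈ T, c i| := by
    rw [norm_mul, Complex.norm_real, Real.norm_eq_abs, norm_mul, Complex.norm_real,
      Real.norm_of_nonneg Real.pi_pos.le]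
    simp
  rw [e1] at hn
  refine hn.trans_eq (intervalIntegral.integral_congr fun t _ => ?_)
  have e2 : ((-m : ℤ) * Complex.I * t : ℂ) = ((-m * t : ℝ) : ℂ) * Complex.I := by
    push_cast; ring
  simp only [norm_mul, e2, Complex.norm_exp_ofReal_mul_I, one_mul, norm_prod]

/-- The squared norm is at most `2(1 + c cos t) = 4(1 - (1 - c cos t)/2)`, and `1 - x ≤ e^{-x}`. -/
theorem norm_one_add_exp_mul_le (c t : ℝ) (hc : |c| ≤ 1) :
    ‖1 + Complex.exp (t * Complex.I) * c‖ ≤ 2 * Real.exp (-(1 - c * Real.cos t) / 4) := by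
  have h1 : ‖1 + Complex.exp (t * Complex.I) * c‖ ^ 2 = 1 + c ^ 2 + 2 * c * Real.cos t := by
    rw [← Complex.normSq_eq_norm_sq, Complex.normSq_apply]
    simp only [Complex.add_re, Complex.one_re, Complex.re_mul_ofReal, Complex.exp_ofReal_mul_I_re,
      Complex.add_im, Complex.one_im, Complex.im_mul_ofReal, Complex.exp_ofReal_mul_I_im]
    linear_combination c ^ 2 * Real.sin_sq_add_cos_sq t
  have hc2 : c ^ 2 ≤ 1 := (sq_le_one_iff_abs_le_one c).2 hc
  refine le_of_sq_le_sq ?_ (by positivity)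
  rw [h1, mul_pow, ← Real.exp_nat_mul]
  have := Real.add_one_le_exp ((2 : ℕ) * (-(1 - c * Real.cos t) / 4))
  push_cast at this ⊢
  linarith

/-- With `r` the mean of the `c i`, `2 r cos t ≤ r² + cos² t` separates the exponent into a part in
`r` and a part in `sin² t`. -/
theorem prod_norm_one_add_exp_mul_le {ι : Type*} [Fintype ι] [Nonempty ι] (c : ι → ℝ)
    (hc : ∀ i, |c i| ≤ 1) (t : ℝ) :
    ∏ i, ‖1 + Complex.exp (t * Complex.I) * c i‖
      ≤ 2 ^ Fintype.card ι *
        Real.exp (-(Fintype.card ι / 8 * (1 - ((∑ i, c i) / Fintype.card ι) ^ 2))) *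
        Real.exp (-(Fintype.card ι / 8) * Real.sin t ^ 2) := by
  have hn : (0 : ℝ) < Fintype.card ι := by exact_mod_cast Fintype.card_pos
  refine (Finset.prod_le_prod (fun _ _ => norm_nonneg _)
    fun i _ => norm_one_add_exp_mul_le (c i) t (hc i)).trans ?_
  rw [Finset.prod_mul_distrib, Finset.prod_const, Finset.card_univ, ← Real.exp_sum, mul_assoc,
    ← Real.exp_add]
  gcongr
  set n : ℝ := (Fintype.card ι : ℝ) with hn'
  obtain ⟨r, hr⟩ : ∃ r, r = (∑ i, c i) / n := ⟨_, rfl⟩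
  have hs : ∑ i, c i = r * n := by rw [hr]; field_simp
  rw [← hr, ← Finset.sum_div, Finset.sum_neg_distrib, Finset.sum_sub_distrib, ← Finset.sum_mul, hs]
  simp only [Finset.sum_const, Finset.card_univ, nsmul_eq_mul, mul_one, ← hn']
  nlinarith [mul_nonneg hn.le (sq_nonneg (r - Real.cos t)), Real.sin_sq_add_cos_sq t]

/-- The integrand has period `π`, so the range is two copies of `[-π/2, π/2]`, where `|sin t| ≥
2|t|/π` leaves a Gaussian. -/
theorem integral_exp_neg_mul_sin_sq_le {a : ℝ} (ha : 0 < a) :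
    ∫ t in (-(Real.pi / 2))..(-(Real.pi / 2)) + 2 * Real.pi, Real.exp (-a * Real.sin t ^ 2)
      ≤ Real.pi * √(Real.pi / a) := by
  have hper : Function.Periodic (fun t => Real.exp (-a * Real.sin t ^ 2)) Real.pi := by
    intro t
    simp [Real.sin_add_pi]
  have hint : ∀ x y, IntervalIntegrable (fun t => Real.exp (-a * Real.sin t ^ 2)) volume x y :=
    fun x y => Continuous.intervalIntegrable (by fun_prop) x y
  have hsplit : ∫ t in (-(Real.pi / 2))..(-(Real.pi / 2)) + 2 * Real.pi,
      Real.exp (-a * Real.sin t ^ 2)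
      = 2 * ∫ t in (-(Real.pi / 2))..(Real.pi / 2), Real.exp (-a * Real.sin t ^ 2) := by
    rw [← intervalIntegral.integral_add_adjacent_intervals (hint _ (Real.pi / 2)) (hint _ _)]
    have := hper.intervalIntegral_add_eq (Real.pi / 2) (-(Real.pi / 2))
    rw [show Real.pi / 2 + Real.pi = -(Real.pi / 2) + 2 * Real.pi by ring,
      show -(Real.pi / 2) + Real.pi = Real.pi / 2 by ring] at this
    rw [this]
    ring
  have hle : ∫ t in (-(Real.pi / 2))..(Real.pi / 2), Real.exp (-a * Real.sin t ^ 2)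
      ≤ ∫ t in (-(Real.pi / 2))..(Real.pi / 2), Real.exp (-(a * (2 / Real.pi) ^ 2) * t ^ 2) := by
    refine intervalIntegral.integral_mono_on (by linarith [Real.pi_pos]) (hint _ _)
      (Continuous.intervalIntegrable (by fun_prop) _ _) fun t ht => ?_
    have h1 := Real.mul_abs_le_abs_sin (abs_le.2 ht)
    have h2 := pow_le_pow_left₀ (by positivity) h1 2
    rw [mul_pow, sq_abs, sq_abs] at h2
    apply Real.exp_le_exp.2
    nlinarith
  have hG : ∫ t in (-(Real.pi / 2))..(Real.pi / 2), Real.exp (-(a * (2 / Real.pi) ^ 2) * t ^ 2)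
      ≤ √(Real.pi / (a * (2 / Real.pi) ^ 2)) := by
    rw [← integral_gaussian, intervalIntegral.integral_of_le (by linarith [Real.pi_pos])]
    exact setIntegral_le_integral (integrable_exp_neg_mul_sq (by positivity))
      (Filter.Eventually.of_forall fun _ => (Real.exp_pos _).le)
  have hsq : √(Real.pi / (a * (2 / Real.pi) ^ 2)) = Real.pi / 2 * √(Real.pi / a) := by
    rw [show Real.pi / (a * (2 / Real.pi) ^ 2) = (Real.pi / 2) ^ 2 * (Real.pi / a) by
      field_simp, Real.sqrt_mul (by positivity), Real.sqrt_sq (by positivity)]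
  rw [hsplit]
  linarith

theorem four_pow_le_two_sqrt_mul_centralBinom {k : ℕ} (hk : 0 < k) :
    (4 : ℝ) ^ k ≤ 2 * √k * k.centralBinom := by
  have hsq : ∀ k : ℕ, 0 < k → ((4 : ℝ) ^ k) ^ 2 ≤ 4 * k * (k.centralBinom : ℝ) ^ 2 := by
    intro k hk
    induction k, hk using Nat.le_induction with
    | base => norm_num [Nat.centralBinom]
    | succ k hk ih =>
      have hrec : ((k : ℝ) + 1) * (k + 1).centralBinom = 2 * (2 * k + 1) * k.centralBinom := by
        exact_mod_cast Nat.succ_mul_centralBinom_succ k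
      have hk' : (0 : ℝ) < k := by exact_mod_cast hk
      push_cast
      have h2 : (((k : ℝ) + 1) * (k + 1).centralBinom) ^ 2
          = (2 * (2 * k + 1) * k.centralBinom) ^ 2 := by rw [hrec]
      refine le_of_mul_le_mul_left ?_ (by linarith : (0 : ℝ) < k + 1)
      have e : ((k : ℝ) + 1) * (4 * (k + 1) * ((k + 1).centralBinom : ℝ) ^ 2)
          = 16 * (2 * k + 1) ^ 2 * (k.centralBinom : ℝ) ^ 2 := by linear_combination 4 * h2
      rw [e, pow_succ (4 : ℝ) k, mul_pow]
      have hb := sq_nonneg (k.centralBinom : ℝ)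
      calc ((k : ℝ) + 1) * (((4 : ℝ) ^ k) ^ 2 * 4 ^ 2)
          ≤ (k + 1) * (4 * k * (k.centralBinom : ℝ) ^ 2 * 4 ^ 2) := by gcongr
        _ ≤ _ := by nlinarith
  refine le_of_sq_le_sq ?_ (by positivity)
  rw [mul_pow, mul_pow, Real.sq_sqrt (by positivity)]
  linarith [hsq k hk]

theorem abs_sum_prod_powersetCard_half_le {ι : Type*} [Fintype ι] (c : ι → ℝ)
    (hc : ∀ i, |c i| ≤ 1) {k : ℕ} (hk : 0 < k) (hcard : Fintype.card ι = 2 * k) :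
    |∑ T ∈ Finset.powersetCard k Finset.univ, ∏ i ∈ T, c i|
      ≤ 4 * k.centralBinom *
        Real.exp (-(Fintype.card ι / 8 * (1 - ((∑ i, c i) / Fintype.card ι) ^ 2))) := by
  have : Nonempty ι := Fintype.card_pos_iff.1 (by omega)
  have hk' : (0 : ℝ) < k := by exact_mod_cast hk
  set E := Real.exp (-(Fintype.card ι / 8 * (1 - ((∑ i, c i) / Fintype.card ι) ^ 2))) with hE
  have hE0 : 0 < E := Real.exp_pos _
  have h1 := two_pi_mul_abs_sum_prod_le c k (-(Real.pi / 2))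
  have h2 : ∫ t in (-(Real.pi / 2))..(-(Real.pi / 2)) + 2 * Real.pi,
        ∏ i, ‖1 + Complex.exp (t * Complex.I) * c i‖
      ≤ ∫ t in (-(Real.pi / 2))..(-(Real.pi / 2)) + 2 * Real.pi,
        2 ^ Fintype.card ι * E * Real.exp (-(Fintype.card ι / 8) * Real.sin t ^ 2) := by
    refine intervalIntegral.integral_mono_on (by linarith [Real.pi_pos])
      (Continuous.intervalIntegrable (by fun_prop) _ _)
      (Continuous.intervalIntegrable (by fun_prop) _ _) fun t _ =>
        prod_norm_one_add_exp_mul_le c hc t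
  rw [intervalIntegral.integral_const_mul] at h2
  have hcard' : (Fintype.card ι : ℝ) = 2 * k := by exact_mod_cast hcard
  have h3 := integral_exp_neg_mul_sin_sq_le (a := Fintype.card ι / 8) (by rw [hcard']; positivity)
  have h4 := four_pow_le_two_sqrt_mul_centralBinom hk
  -- The `1/√n` of the integral meets the `√k` of the central binomial bound; their product is
  -- `√(4π) ≤ 4`.
  have h5 : √(Real.pi / (Fintype.card ι / 8)) * √k ≤ 4 := by
    rw [← Real.sqrt_mul (by positivity), hcard']
    rw [show Real.pi / (2 * (k : ℝ) / 8) * k = 4 * Real.pi by field_simp; norm_num]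
    exact Real.sqrt_le_iff.2 ⟨by norm_num, by linarith [Real.pi_le_four]⟩
  have h6 : (2 : ℝ) ^ Fintype.card ι ≤ 2 * √k * k.centralBinom := by
    rw [hcard, pow_mul]
    norm_num
    exact h4
  have h7 : 2 * Real.pi * |∑ T ∈ Finset.powersetCard k Finset.univ, ∏ i ∈ T, c i|
      ≤ 2 * Real.pi * (4 * k.centralBinom * E) := by
    calc _ ≤ 2 ^ Fintype.card ι * E * (Real.pi * √(Real.pi / (Fintype.card ι / 8))) :=
          h1.trans (h2.trans (by gcongr))
      _ ≤ (2 * √k * k.centralBinom) * E * (Real.pi * √(Real.pi / (Fintype.card ι / 8))) := by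
          gcongr
      _ = 2 * Real.pi * ((√(Real.pi / (Fintype.card ι / 8)) * √k) * k.centralBinom * E) := by ring
      _ ≤ _ := by gcongr
  exact le_of_mul_le_mul_left h7 (by positivity)

/-! ### Counting signed vectors, and the characteristic function of the sum. -/

/-- The vectors in `{-1, 0, 1}ⁿ` with exactly `k` nonzero entries. -/
def signedVectorsFinset (n k : ℕ) : Finset (Fin n → ℤ) :=
  (Fintype.piFinset fun _ => ({-1, 0, 1} : Finset ℤ)).filter fun x => ∑ i, |x i| = k

theorem coe_signedVectorsFinset (k : ℕ) :
    (signedVectorsFinset (2 * k) k : Set (Fin (2 * k) → ℤ)) = signedHalfVectors (2 * k) := by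
  ext x
  simp only [signedVectorsFinset, Finset.coe_filter, Fintype.mem_piFinset, Finset.mem_insert,
    Finset.mem_singleton, Set.mem_ofPred_eq, signedHalfVectors]
  refine and_congr_right fun _ => ?_
  push_cast
  omega

/-- Group the vectors by support `T`: each fibre is a product set, `{-1, 1}` on `T` and `{0}` off
it, so the sum factors. -/
theorem sum_prod_signedVectorsFinset {n k : ℕ} {R : Type*} [CommSemiring R] (f : Fin n → ℤ → R)
    (hf : ∀ i, f i 0 = 1) :
    ∑ x ∈ signedVectorsFinset n k, ∏ i, f i (x i)
      = ∑ T ∈ Finset.powersetCard k Finset.univ, ∏ i ∈ T, (f i (-1) + f i 1) := by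
  have hval : ∀ x : Fin n → ℤ, (∀ i, x i = -1 ∨ x i = 0 ∨ x i = 1) →
      ∑ i, |x i| = ((Finset.univ.filter fun i => x i ≠ 0).card : ℤ) := by
    intro x hx
    rw [Finset.card_filter]
    push_cast
    refine Finset.sum_congr rfl fun i _ => ?_
    rcases hx i with h | h | h <;> simp [h]
  rw [← Finset.sum_fiberwise_of_maps_to
    (g := fun x : Fin n → ℤ => Finset.univ.filter fun i => x i ≠ 0)
    (t := Finset.powersetCard k Finset.univ)]
  · refine Finset.sum_congr rfl fun T hT => ?_
    have hT' := (Finset.mem_powersetCard.1 hT).2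
    have hfib : ((signedVectorsFinset n k).filter
        fun x => (Finset.univ.filter fun i => x i ≠ 0) = T)
        = Fintype.piFinset fun i => if i ∈ T then ({-1, 1} : Finset ℤ) else {0} := by
      ext x
      simp only [signedVectorsFinset, Finset.mem_filter, Fintype.mem_piFinset, Finset.mem_insert,
        Finset.mem_singleton]
      constructor
      · rintro ⟨⟨hx, -⟩, rfl⟩ i
        by_cases h : x i = 0
        · simp [h]
        · have := hx i
          simp only [Finset.mem_filter, Finset.mem_univ, true_and, ne_eq, h, not_false_eq_true,
            if_true, Finset.mem_insert, Finset.mem_singleton]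
          tauto
      · intro hx
        have hx1 : ∀ i, x i = -1 ∨ x i = 0 ∨ x i = 1 := by
          intro i
          have := hx i
          split_ifs at this <;> simp at this <;> tauto
        have hx2 : (Finset.univ.filter fun i => x i ≠ 0) = T := by
          ext i
          have := hx i
          simp only [Finset.mem_filter, Finset.mem_univ, true_and]
          split_ifs at this with h
          · simp only [Finset.mem_insert, Finset.mem_singleton] at this
            simp only [h, iff_true]
            omega
          · simp only [Finset.mem_singleton] at this
            simp [h, this]
        exact ⟨⟨hx1, by rw [hval x hx1, hx2, hT']⟩, hx2⟩
    rw [hfib, ← Finset.prod_univ_sum, ← Finset.prod_subset (Finset.subset_univ T)]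
    · refine Finset.prod_congr rfl fun i hi => ?_
      rw [if_pos hi, Finset.sum_pair (by norm_num)]
    · intro i _ hi
      rw [if_neg hi, Finset.sum_singleton, hf]
  · intro x hx
    simp only [signedVectorsFinset, Finset.mem_filter, Fintype.mem_piFinset, Finset.mem_insert,
      Finset.mem_singleton] at hx
    refine Finset.mem_powersetCard.2 ⟨Finset.subset_univ _, ?_⟩
    have := hval x hx.1
    omega

theorem card_signedVectorsFinset (n k : ℕ) :
    (signedVectorsFinset n k).card = n.choose k * 2 ^ k := by
  have h := sum_prod_signedVectorsFinset (n := n) (k := k) (R := ℕ) (fun _ _ => 1) fun _ => rfl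
  simp only [Finset.prod_const_one, Finset.sum_const, smul_eq_mul, mul_one] at h
  rw [h, Finset.sum_congr rfl fun T hT => by
    rw [Finset.prod_const, (Finset.mem_powersetCard.1 hT).2]]
  simp

theorem sum_cos_signedVectorsFinset_le {k : ℕ} (hk : 0 < k) (v : Fin (2 * k) → ℝ) (θ y : ℝ) :
    ∑ x ∈ signedVectorsFinset (2 * k) k, Real.cos (θ * (∑ i, (x i : ℝ) * v i - y))
      ≤ 4 * (signedVectorsFinset (2 * k) k).card *
        Real.exp (-((2 * k : ℕ) / 8 * (1 - ((∑ i, Real.cos (θ * v i)) / (2 * k : ℕ)) ^ 2))) := by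
  have h1 : ∑ x ∈ signedVectorsFinset (2 * k) k,
      Complex.exp ((θ * (∑ i, (x i : ℝ) * v i - y) : ℝ) * Complex.I)
      = Complex.exp ((-(θ * y) : ℝ) * Complex.I) *
        ((2 ^ k * ∑ T ∈ Finset.powersetCard k Finset.univ,
          ∏ i ∈ T, Real.cos (θ * v i) : ℝ) : ℂ) := by
    have h := sum_prod_signedVectorsFinset (n := 2 * k) (k := k)
      (fun i z => Complex.exp ((θ * (z * v i) : ℝ) * Complex.I)) (by simp)
    have h2 : ∑ T ∈ Finset.powersetCard k (Finset.univ : Finset (Fin (2 * k))),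
        ∏ i ∈ T, (Complex.exp ((θ * ((-1 : ℤ) * v i) : ℝ) * Complex.I)
          + Complex.exp ((θ * ((1 : ℤ) * v i) : ℝ) * Complex.I))
        = ((2 ^ k * ∑ T ∈ Finset.powersetCard k Finset.univ,
          ∏ i ∈ T, Real.cos (θ * v i) : ℝ) : ℂ) := by
      push_cast
      rw [Finset.mul_sum]
      refine Finset.sum_congr rfl fun T hT => ?_
      have hpow : (2 : ℂ) ^ k = ∏ _i ∈ T, 2 := by
        rw [Finset.prod_const, (Finset.mem_powersetCard.1 hT).2]
      rw [hpow, ← Finset.prod_mul_distrib]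
      refine Finset.prod_congr rfl fun i _ => ?_
      rw [Complex.two_cos, add_comm]
      congr 2 <;> ring
    rw [← h2, ← h, Finset.mul_sum]
    refine Finset.sum_congr rfl fun x _ => ?_
    rw [← Complex.exp_sum, ← Complex.exp_add, ← Finset.sum_mul, ← add_mul]
    congr 2
    push_cast
    rw [← Finset.mul_sum]
    ring
  have h2 : ∑ x ∈ signedVectorsFinset (2 * k) k, Real.cos (θ * (∑ i, (x i : ℝ) * v i - y))
      = (∑ x ∈ signedVectorsFinset (2 * k) k,
        Complex.exp ((θ * (∑ i, (x i : ℝ) * v i - y) : ℝ) * Complex.I)).re := by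
    rw [Complex.re_sum]
    exact Finset.sum_congr rfl fun x _ => (Complex.exp_ofReal_mul_I_re _).symm
  have h3 := abs_sum_prod_powersetCard_half_le (fun i => Real.cos (θ * v i))
    (fun i => Real.abs_cos_le_one _) hk (Fintype.card_fin (2 * k))
  rw [Fintype.card_fin] at h3
  rw [h2, h1]
  refine (Complex.re_le_norm _).trans ?_
  rw [norm_mul, Complex.norm_exp_ofReal_mul_I, one_mul, Complex.norm_real, Real.norm_eq_abs,
    abs_mul, abs_of_nonneg (by positivity), card_signedVectorsFinset,
    ← Nat.centralBinom_eq_two_mul_choose]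
  calc _ ≤ (2 : ℝ) ^ k * _ := mul_le_mul_of_nonneg_left h3 (by positivity)
    _ = _ := by push_cast; ring

/-! ### Distance of `θ D(v)` to the integer lattice. -/

/-- `1 - cos 2πx = 2 sin² πx`, and `|sin πy| ≥ 2|y|` for `y = x - round x`, since `|y| ≤ 1/2`. -/
theorem sq_sub_round_le (x : ℝ) :
    (x - round x) ^ 2 ≤ (1 - Real.cos (2 * Real.pi * x)) / 8 := by
  have h1 : Real.cos (2 * Real.pi * x) = Real.cos (2 * (Real.pi * (x - round x))) := by
    rw [← Real.cos_sub_int_mul_two_pi _ (round x)]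
    congr 1
    ring
  have h2 : |Real.pi * (x - round x)| ≤ Real.pi / 2 := by
    rw [abs_mul, abs_of_pos Real.pi_pos]
    nlinarith [abs_sub_round x, Real.pi_pos]
  have h3 := pow_le_pow_left₀ (by positivity) (Real.mul_abs_le_abs_sin h2) 2
  rw [mul_pow, sq_abs, sq_abs] at h3
  have h4 : (2 / Real.pi) ^ 2 * (Real.pi * (x - round x)) ^ 2 = 4 * (x - round x) ^ 2 := by
    field_simp
    ring
  rw [h1, Real.cos_two_mul']
  nlinarith [Real.sin_sq_add_cos_sq (Real.pi * (x - round x))]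

theorem sum_pairIdx_le_half_sum {n : ℕ} (f : Fin n → Fin n → ℝ) (hf : ∀ i j, 0 ≤ f i j)
    (hsymm : ∀ i j, f i j = f j i) :
    ∑ p : PairIdx n, f p.1.1 p.1.2 ≤ (∑ i, ∑ j, f i j) / 2 := by
  have h1 : ∑ p : PairIdx n, f p.1.1 p.1.2
      = ∑ p : Fin n × Fin n, if p.1 < p.2 then f p.1 p.2 else 0 := by
    rw [← Finset.sum_filter]
    exact (Finset.sum_subtype (Finset.univ.filter fun p : Fin n × Fin n => p.1 < p.2)
      (by simp) fun p => f p.1 p.2).symm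
  have h2 : ∑ p : Fin n × Fin n, (if p.1 < p.2 then f p.1 p.2 else 0)
      = ∑ p : Fin n × Fin n, if p.2 < p.1 then f p.1 p.2 else 0 := by
    rw [← (Equiv.prodComm (Fin n) (Fin n)).sum_comp]
    refine Finset.sum_congr rfl fun p _ => ?_
    simp [hsymm p.2 p.1]
  rw [← Fintype.sum_prod_type', le_div_iff₀ two_pos, mul_two, h1]
  conv_lhs => rw [h2]
  nth_rw 2 [← h2]
  rw [← Finset.sum_add_distrib]
  refine Finset.sum_le_sum fun p _ => ?_
  have := hf p.1 p.2
  split_ifs with h h'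
  · exact absurd h' h.asymm
  all_goals linarith

theorem infDist_sq_smul_diffVec_le {n : ℕ} (hn : 0 < n) (v : EuclideanSpace ℝ (Fin n)) (θ : ℝ) :
    Metric.infDist (θ • diffVec v) (intLattice (PairIdx n)) ^ 2
      ≤ (n : ℝ) ^ 2 / 16 * (1 - ((∑ i, Real.cos (2 * Real.pi * θ * v i)) / n) ^ 2) := by
  set z : EuclideanSpace ℝ (PairIdx n) :=
    WithLp.toLp 2 fun p => ((round (θ * (v p.1.1 - v p.1.2)) : ℤ) : ℝ)
  have hz : z ∈ intLattice (PairIdx n) := fun p => ⟨_, rfl⟩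
  have h1 := pow_le_pow_left₀ Metric.infDist_nonneg
    (Metric.infDist_le_dist_of_mem (x := θ • diffVec v) hz) 2
  rw [dist_eq_norm, EuclideanSpace.norm_sq_eq] at h1
  have hn' : (n : ℝ) ≠ 0 := by positivity
  set a : Fin n → ℝ := fun i => 2 * Real.pi * θ * v i with ha
  calc _ ≤ _ := h1
    _ ≤ ∑ p : PairIdx n, (1 - Real.cos (a p.1.1 - a p.1.2)) / 8 := by
        refine Finset.sum_le_sum fun p _ => ?_
        rw [Real.norm_eq_abs, sq_abs]
        refine (sq_sub_round_le (θ * (v p.1.1 - v p.1.2))).trans_eq ?_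
        simp only [ha]
        ring_nf
    _ ≤ (∑ i, ∑ j, (1 - Real.cos (a i - a j)) / 8) / 2 := by
        refine sum_pairIdx_le_half_sum (fun i j => (1 - Real.cos (a i - a j)) / 8)
          (fun i j => by linarith [Real.cos_le_one (a i - a j)]) fun i j => ?_
        rw [← Real.cos_neg, neg_sub]
    -- The double sum of `cos (a i - a j)` is `|∑ exp (i a_j)|²`; its sine part is then dropped.
    _ = ((n : ℝ) ^ 2 - (∑ i, Real.cos (a i)) ^ 2 - (∑ i, Real.sin (a i)) ^ 2) / 16 := by
        simp only [Real.cos_sub, ← Finset.sum_div, Finset.sum_sub_distrib, Finset.sum_add_distrib,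
          ← Finset.mul_sum, ← Finset.sum_mul]
        simp
        ring
    _ ≤ ((n : ℝ) ^ 2 - (∑ i, Real.cos (a i)) ^ 2) / 16 := by
        linarith [sq_nonneg (∑ i, Real.sin (a i))]
    _ = _ := by
        simp only [ha]
        field_simp

/-! ### Esseen's inequality. -/

/-- Esseen's inequality for a finite family, under a Gaussian-plus-constant bound on the
characteristic function. -/
theorem card_abs_sub_le_of_sum_cos_le {κ : Type*} (S : Finset κ) (W : κ → ℝ) {ε : ℝ} (hε : 0 < ε)
    {A E c : ℝ} (hA : 0 ≤ A) (hc : 0 < c) (y : ℝ)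
    (h : ∀ θ, |θ| ≤ 1 / ε → ∑ x ∈ S, Real.cos (θ * (W x - y)) ≤ A * (E + Real.exp (-c * θ ^ 2))) :
    ((S.filter fun x => |W x - y| ≤ ε).card : ℝ) ≤ 4 * A * (E + ε * √(Real.pi / c)) := by
  set u : κ → ℝ := fun x => (W x - y) / ε with hu
  -- `C x` and `D x` are the real and imaginary parts of `∫₀¹ e^{isu} ds` at `u = u x`. So `C² + D²`
  -- is the integral of `cos((t - s)u)` over the unit square: it is nonnegative, at least `1/4` when
  -- `|u| ≤ 1`, and uses only frequencies `(t - s)/ε` of size at most `1/ε`.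
  set C : κ → ℝ := fun x => ∫ s in (0 : ℝ)..1, Real.cos (s * u x) with hC
  set D : κ → ℝ := fun x => ∫ s in (0 : ℝ)..1, Real.sin (s * u x) with hD
  have hcos : ∀ z a b : ℝ, IntervalIntegrable (fun s => Real.cos (s * z)) volume a b :=
    fun z a b => Continuous.intervalIntegrable (by fun_prop) a b
  have hsin : ∀ z a b : ℝ, IntervalIntegrable (fun s => Real.sin (s * z)) volume a b :=
    fun z a b => Continuous.intervalIntegrable (by fun_prop) a b
  have hgauss : ∀ t : ℝ, ∫ s in (0 : ℝ)..1, Real.exp (-c * ((t - s) / ε) ^ 2)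
      ≤ ε * √(Real.pi / c) := by
    intro t
    have e1 : ∀ s, Real.exp (-c * ((t - s) / ε) ^ 2) = Real.exp (-(c / ε ^ 2) * (t - s) ^ 2) := by
      intro s
      congr 1
      field_simp
    have hi : Integrable (fun s => Real.exp (-(c / ε ^ 2) * (t - s) ^ 2)) :=
      (integrable_exp_neg_mul_sq (b := c / ε ^ 2) (by positivity)).comp_sub_left t
    simp_rw [e1]
    rw [intervalIntegral.integral_of_le zero_le_one]
    refine (setIntegral_le_integral hi
      (Filter.Eventually.of_forall fun _ => (Real.exp_pos _).le)).trans_eq ?_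
    rw [integral_sub_left_eq_self (fun s => Real.exp (-(c / ε ^ 2) * s ^ 2)), integral_gaussian,
      show Real.pi / (c / ε ^ 2) = ε ^ 2 * (Real.pi / c) by field_simp,
      Real.sqrt_mul (by positivity), Real.sqrt_sq hε.le]
  have hinner : ∀ t ∈ Set.Icc (0 : ℝ) 1,
      ∑ x ∈ S, (Real.cos (t * u x) * C x + Real.sin (t * u x) * D x)
        ≤ A * (E + ε * √(Real.pi / c)) := by
    intro t ht
    calc _ = ∫ s in (0 : ℝ)..1, ∑ x ∈ S, Real.cos ((t - s) / ε * (W x - y)) := by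
          rw [intervalIntegral.integral_finsetSum fun x _ =>
            Continuous.intervalIntegrable (by fun_prop) _ _]
          refine Finset.sum_congr rfl fun x _ => ?_
          rw [hC, hD]
          rw [← intervalIntegral.integral_const_mul, ← intervalIntegral.integral_const_mul,
            ← intervalIntegral.integral_add ((hcos _ _ _).const_mul _) ((hsin _ _ _).const_mul _)]
          refine intervalIntegral.integral_congr fun s _ => ?_
          rw [← Real.cos_sub]
          congr 1
          simp only [hu]
          ring
      _ ≤ ∫ s in (0 : ℝ)..1, A * (E + Real.exp (-c * ((t - s) / ε) ^ 2)) := by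
          refine intervalIntegral.integral_mono_on zero_le_one
            (Continuous.intervalIntegrable (by fun_prop) _ _)
            (Continuous.intervalIntegrable (by fun_prop) _ _) fun s hs => h _ ?_
          rw [abs_div, abs_of_pos hε]
          gcongr
          exact abs_le.2 ⟨by linarith [ht.1, hs.2], by linarith [ht.2, hs.1]⟩
      _ = A * (E + ∫ s in (0 : ℝ)..1, Real.exp (-c * ((t - s) / ε) ^ 2)) := by
          rw [intervalIntegral.integral_const_mul, intervalIntegral.integral_add (by simp)
            (Continuous.intervalIntegrable (by fun_prop) _ _)]
          simp
      _ ≤ _ := by gcongr; exact hgauss t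
  have houter : ∑ x ∈ S, (C x ^ 2 + D x ^ 2) ≤ A * (E + ε * √(Real.pi / c)) := by
    calc _ = ∫ t in (0 : ℝ)..1,
          ∑ x ∈ S, (Real.cos (t * u x) * C x + Real.sin (t * u x) * D x) := by
          rw [intervalIntegral.integral_finsetSum fun x _ =>
            ((hcos _ _ _).mul_const _).add ((hsin _ _ _).mul_const _)]
          refine Finset.sum_congr rfl fun x _ => ?_
          rw [intervalIntegral.integral_add ((hcos _ _ _).mul_const _) ((hsin _ _ _).mul_const _),
            intervalIntegral.integral_mul_const, intervalIntegral.integral_mul_const, sq, sq]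
      _ ≤ ∫ t in (0 : ℝ)..1, A * (E + ε * √(Real.pi / c)) :=
          intervalIntegral.integral_mono_on zero_le_one
            (Continuous.intervalIntegrable (by fun_prop) _ _) (by simp) hinner
      _ = _ := by simp
  have hlow : ∀ x ∈ S.filter fun x => |W x - y| ≤ ε, (1 / 4 : ℝ) ≤ C x ^ 2 + D x ^ 2 := by
    intro x hx
    have hux : |u x| ≤ 1 := by
      rw [hu]
      simp only
      rw [abs_div, abs_of_pos hε]
      exact (div_le_one hε).2 (Finset.mem_filter.1 hx).2
    have hCx : 1 / 2 ≤ C x := by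
      calc (1 / 2 : ℝ) = ∫ s in (0 : ℝ)..1, (1 / 2 : ℝ) := by simp
        _ ≤ _ := by
          refine intervalIntegral.integral_mono_on zero_le_one (by simp) (hcos _ _ _) fun s hs => ?_
          have h1 : (s * u x) ^ 2 ≤ 1 := by
            rw [sq_le_one_iff_abs_le_one, abs_mul, abs_of_nonneg hs.1]
            exact mul_le_one₀ hs.2 (abs_nonneg _) hux
          linarith [Real.one_sub_sq_div_two_le_cos (x := s * u x)]
    nlinarith [sq_nonneg (D x)]
  have hsum : ((S.filter fun x => |W x - y| ≤ ε).card : ℝ) * (1 / 4)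
      ≤ ∑ x ∈ S, (C x ^ 2 + D x ^ 2) := by
    rw [← nsmul_eq_mul]
    exact (Finset.card_nsmul_le_sum _ _ _ hlow).trans
      (Finset.sum_le_sum_of_subset_of_nonneg (Finset.filter_subset _ _)
        fun x _ _ => by positivity)
  linarith

/-! ### From the CLCD to small ball probabilities. -/

theorem exp_neg_le_of_notMem_clcdSet {n : ℕ} (hn : 0 < n) {b γ α : ℝ} (hb : 0 < b) (hγ : 0 < γ)
    (hα : 0 < α) (v : EuclideanSpace ℝ (Fin n)) (hv : b * √n ≤ ‖diffVec v‖) (θ : ℝ)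
    (hθ : |θ| / (2 * Real.pi) ∉ clcdSet α γ v) :
    Real.exp (-((n : ℝ) / 8 * (1 - ((∑ i, Real.cos (θ * v i)) / n) ^ 2)))
      ≤ Real.exp (-2 * α ^ 2 / n)
        + Real.exp (-(γ ^ 2 * b ^ 2 / (2 * Real.pi ^ 2)) * θ ^ 2) := by
  have hπ := Real.pi_pos
  have hn' : (0 : ℝ) < n := by exact_mod_cast hn
  set τ := |θ| / (2 * Real.pi) with hτ
  have hcos : ∀ i, Real.cos (2 * Real.pi * τ * v i) = Real.cos (θ * v i) := by
    intro i
    rw [hτ, mul_div_cancel₀ _ (by positivity), ← Real.cos_abs (θ * v i), ← Real.cos_abs (|θ| * v i),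
      abs_mul, abs_mul, abs_abs]
  have hd := infDist_sq_smul_diffVec_le hn v τ
  simp only [hcos] at hd
  set d := Metric.infDist (τ • diffVec v) (intLattice (PairIdx n)) with hd_def
  have hle : -((n : ℝ) / 8 * (1 - ((∑ i, Real.cos (θ * v i)) / n) ^ 2)) ≤ -(2 * d ^ 2 / n) := by
    rw [neg_le_neg_iff, div_le_iff₀ hn']
    linarith
  refine (Real.exp_le_exp.2 hle).trans ?_
  -- At `θ = 0` non-membership in `clcdSet` says nothing, as that set requires positivity; there the
  -- Gaussian term equals `1`.
  rcases eq_or_ne θ 0 with rfl | h0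
  · have h1 : Real.exp (-(2 * d ^ 2 / n)) ≤ 1 :=
      Real.exp_le_one_iff.2 (neg_nonpos.2 (by positivity))
    simpa using h1.trans (le_add_of_nonneg_left (Real.exp_pos _).le)
  have hτ0 : 0 < τ := by positivity
  have hmin : min (γ * ‖τ • diffVec v‖) α ≤ d := not_lt.1 fun hlt => hθ ⟨hτ0, hlt⟩
  rcases min_le_iff.1 hmin with h | h
  · refine le_add_of_nonneg_of_le (Real.exp_pos _).le (Real.exp_le_exp.2 ?_)
    rw [norm_smul, Real.norm_of_nonneg hτ0.le] at h
    have h1 : γ * (τ * (b * √n)) ≤ d := le_trans (by gcongr) h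
    have h2 := pow_le_pow_left₀ (by positivity) h1 2
    have h3 : (γ * (τ * (b * √n))) ^ 2 = γ ^ 2 * b ^ 2 / (2 * Real.pi ^ 2) * θ ^ 2 * n / 2 := by
      simp only [mul_pow, Real.sq_sqrt hn'.le, hτ, div_pow, sq_abs]
      field_simp
    rw [neg_mul, neg_le_neg_iff, le_div_iff₀ hn']
    linarith
  · refine le_add_of_le_of_nonneg (Real.exp_le_exp.2 ?_) (Real.exp_pos _).le
    rw [neg_mul, neg_div, neg_le_neg_iff]
    gcongr

theorem card_signedVectorsFinset_abs_sub_le {k : ℕ} (hk : 0 < k) {b γ α : ℝ} (hb : 0 < b)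
    (hγ : 0 < γ) (hα : 0 < α) (v : EuclideanSpace ℝ (Fin (2 * k)))
    (hv : b * √(2 * k : ℕ) ≤ ‖diffVec v‖) {δ : ℝ} (hδ : 0 < δ)
    (hset : ∀ θ ∈ clcdSet α γ v, 1 / δ ≤ θ) (y : ℝ) :
    (((signedVectorsFinset (2 * k) k).filter
        fun x => |∑ i, (x i : ℝ) * v i - y| ≤ δ).card : ℝ)
      ≤ 16 * (signedVectorsFinset (2 * k) k).card * (Real.exp (-2 * α ^ 2 / (2 * k : ℕ))
        + δ * √(Real.pi / (γ ^ 2 * b ^ 2 / (2 * Real.pi ^ 2)))) := by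
  have hπ := Real.pi_pos
  have h := card_abs_sub_le_of_sum_cos_le (signedVectorsFinset (2 * k) k)
    (fun x => ∑ i, (x i : ℝ) * v i) hδ (A := 4 * (signedVectorsFinset (2 * k) k).card)
    (E := Real.exp (-2 * α ^ 2 / (2 * k : ℕ))) (c := γ ^ 2 * b ^ 2 / (2 * Real.pi ^ 2))
    (by positivity) (by positivity) y fun θ hθ => by
      refine (sum_cos_signedVectorsFinset_le hk v θ y).trans ?_
      refine mul_le_mul_of_nonneg_left
        (exp_neg_le_of_notMem_clcdSet (by omega) hb hγ hα v hv θ fun hmem => ?_) (by positivity)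
      have h1 := (hset _ hmem).trans (div_le_div_of_nonneg_right hθ (by positivity))
      -- Frequencies up to `1/δ` become `τ ≤ 1/(2πδ)`, strictly below every element of `clcdSet`.
      have h2 : 1 / δ / (2 * Real.pi) < 1 / δ :=
        div_lt_self (by positivity) (by linarith [Real.pi_gt_three])
      exact absurd h1 (not_le.2 h2)
  refine h.trans_eq ?_
  ring

theorem measure_eq_card_div_card {k : ℕ} {Ω : Type*} [MeasurableSpace Ω]
    {P : Measure Ω} {ξ : Ω → Fin (2 * k) → ℤ}
    (hξ : HasLaw ξ (uniformOn (signedHalfVectors (2 * k))) P) (p : (Fin (2 * k) → ℤ) → Prop)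
    [DecidablePred p] :
    P {ω | p (ξ ω)} = ENNReal.ofReal (((signedVectorsFinset (2 * k) k).filter p).card
      / (signedVectorsFinset (2 * k) k).card) := by
  have hpos : 0 < (signedVectorsFinset (2 * k) k).card := by
    rw [card_signedVectorsFinset]
    exact Nat.mul_pos (Nat.choose_pos (by omega)) (by positivity)
  rw [hξ.measure_eq (p := p) MeasurableSet.of_discrete, uniformOn,
    cond_apply MeasurableSet.of_discrete, ← coe_signedVectorsFinset]
  have hinter : (signedVectorsFinset (2 * k) k : Set (Fin (2 * k) → ℤ)) ∩ {x | p x}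
      = ((signedVectorsFinset (2 * k) k).filter p : Finset _) := by
    ext x
    simp
  rw [hinter, Measure.count_apply_finset, Measure.count_apply_finset,
    ENNReal.ofReal_div_of_pos (by exact_mod_cast hpos), ENNReal.ofReal_natCast,
    ENNReal.ofReal_natCast, mul_comm, ENNReal.div_eq_inv_mul, mul_comm]

theorem theorem1p3 (b : ℝ) (hb : 0 < b) (γ : ℝ) (hγ0 : 0 < γ) (hγ1 : γ < 1) :
    ∃ C : ℝ, 0 < C ∧
      ∀ (n : ℕ), 0 < n → Even n →
      ∀ {Ω : Type*} [MeasurableSpace Ω] (P : Measure Ω) [IsProbabilityMeasure P]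
        (ξ : Ω → Fin n → ℤ), HasLaw ξ (uniformOn (signedHalfVectors n)) P →
      ∀ v : EuclideanSpace ℝ (Fin n), b * Real.sqrt n ≤ ‖diffVec v‖ →
      ∀ α : ℝ, 0 < α → ∀ ε : ℝ, 0 ≤ ε →
        levyConcentration P (signedSum ξ v) ε ≤
          ENNReal.ofReal (C * ε) + ENNReal.ofReal C / clcd α γ v
            + ENNReal.ofReal (C * Real.exp (-2 * α ^ 2 / n)) := by
  set R := √(Real.pi / (γ ^ 2 * b ^ 2 / (2 * Real.pi ^ 2))) with hR
  have hR0 : 0 ≤ R := Real.sqrt_nonneg _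
  -- `16` is the `4` of the characteristic function bound times the `4` of Esseen's; `R` comes from
  -- the Gaussian integral.
  have hC0 : 0 < 16 * (1 + R) := by positivity
  refine ⟨16 * (1 + R), hC0, ?_⟩
  intro n hn heven Ω _ P _ ξ hξ v hv α hα ε hε
  obtain ⟨k, rfl⟩ := even_iff_exists_two_mul.1 heven
  have hk : 0 < k := by omega
  set C := 16 * (1 + R) with hC
  set E := Real.exp (-2 * α ^ 2 / (2 * k : ℕ)) with hE
  have hE0 : 0 < E := Real.exp_pos _
  have hpos : (0 : ℝ) < (signedVectorsFinset (2 * k) k).card := by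
    rw [card_signedVectorsFinset]
    exact_mod_cast Nat.mul_pos (Nat.choose_pos (by omega)) (by positivity)
  have key : ∀ δ : ℝ, 0 < δ → ε ≤ δ → (∀ θ ∈ clcdSet α γ v, 1 / δ ≤ θ) → ∀ y : ℝ,
      P {ω | |signedSum ξ v ω - y| ≤ ε} ≤ ENNReal.ofReal (C * δ) + ENNReal.ofReal (C * E) := by
    intro δ hδ hεδ hset y
    have h1 := card_signedVectorsFinset_abs_sub_le hk hb hγ0 hα v hv hδ hset y
    rw [← hE, ← hR] at h1
    calc P {ω | |signedSum ξ v ω - y| ≤ ε} ≤ P {ω | |∑ i, (ξ ω i : ℝ) * v i - y| ≤ δ} :=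
          measure_mono fun ω hω => le_trans hω hεδ
      _ = _ := measure_eq_card_div_card hξ fun x => |∑ i, (x i : ℝ) * v i - y| ≤ δ
      _ ≤ ENNReal.ofReal (C * δ + C * E) := by
          refine ENNReal.ofReal_le_ofReal ((div_le_iff₀ hpos).2 (h1.trans ?_))
          have h2 : 16 * (E + δ * R) ≤ C * δ + C * E := by
            rw [hC]
            nlinarith [mul_nonneg hR0 hE0.le]
          linarith [mul_le_mul_of_nonneg_right h2 hpos.le]
      _ = _ := ENNReal.ofReal_add (by positivity) (by positivity)
  refine iSup_le fun y => ?_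
  -- In `ℝ≥0∞` a positive number over `0` is `⊤`, so this case is trivial.
  rcases eq_or_ne (clcd α γ v) 0 with h0 | h0
  · rw [h0, ENNReal.div_zero (by simpa using hC0)]
    simp
  have hmem : ∀ θ ∈ clcdSet α γ v, clcd α γ v ≤ ENNReal.ofReal θ := fun θ hθ => iInf₂_le θ hθ
  rcases eq_or_ne (clcd α γ v) ⊤ with htop | htop
  · have hset : ∀ δ : ℝ, ∀ θ ∈ clcdSet α γ v, 1 / δ ≤ θ := fun δ θ hθ => by
      have := hmem θ hθ
      rw [htop] at this
      simp at this
    rw [htop, ENNReal.div_top, add_zero]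
    -- Any `δ > 0` is admissible here, but `δ = ε` may be `0`; `δ = ε + η/C` costs only `η`.
    refine ENNReal.le_of_forall_pos_le_add fun η hη _ => ?_
    have hη' : (0 : ℝ) < η := hη
    refine (key (ε + η / C) (by positivity) (by linarith [div_pos hη' hC0]) (hset _) y).trans ?_
    rw [mul_add, mul_div_cancel₀ _ hC0.ne', ENNReal.ofReal_add (by positivity) hη'.le,
      ENNReal.ofReal_coe_nnreal, add_right_comm]
  · obtain ⟨L, hL⟩ : ∃ L : ℝ, clcd α γ v = ENNReal.ofReal L ∧ 0 < L :=
      ⟨(clcd α γ v).toReal, (ENNReal.ofReal_toReal htop).symm, ENNReal.toReal_pos h0 htop⟩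
    obtain ⟨hL, hL0⟩ := hL
    -- `L(ε + 1/L) ≥ 1` makes this `δ` admissible, and `C δ` is exactly `C ε + C/L`.
    refine (key (ε + 1 / L) (by positivity) (by linarith [one_div_pos.2 hL0]) ?_ y).trans_eq ?_
    · intro θ hθ
      have h1 := hmem θ hθ
      rw [hL, ENNReal.ofReal_le_ofReal_iff hθ.1.le] at h1
      refine le_trans ?_ h1
      rw [div_le_iff₀ (by positivity), mul_add, mul_one_div_cancel hL0.ne']
      linarith [mul_nonneg hL0.le hε]
    · rw [mul_add, mul_one_div, ENNReal.ofReal_add (by positivity) (by positivity), hL,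
        ENNReal.ofReal_div_of_pos hL0]
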